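/- Let $R$ be an associative ring with unity; all modules are left $R$-modules. An injective $R$-homomorphism $f:A\to B$ is an \emph{$RD$-embedding} if $f[A]\cap rB=rf[A]$ for every $r\in R$, and a \emph{pure embedding} if every finite system of linear equations over $R$ with parameters in $f[A]$ which has a solution in $B$ has a solution in $f[A]$. Let $\mathcal M$ be the class of all embeddings, the class of all $RD$-embeddings, or the class of all pure embeddings. A submodule $N$ of $A$ is an \emph{$\mathcal M$-submodule} if the inclusion $N\hookrightarrow A$ is in $\mathcal M$; a surjective homomorphism $g:A\to B$ is an \emph{$\mathcal M$-epimorphism} if $\ker g$ is an $\mathcal M$-submodule of $A$. Let $K$ be a class of $R$-modules which is closed under direct sums, $\mathcal M$-submodules and $\mathcal M$-epimorphic images (if $A\in K$ and $g:A\to B$ is an $\mathcal M$-epimorphism, then $B\in K$). A module $E$ is \emph{$\mathcal M$-injective relative to $K$} if for every $\mathcal M$-embedding $f:A\to B$ with $A,B\in K$ and every $R$-homomorphism $g:A\to E$ there is an $R$-homomorphism $h:B\to E$ with $h\circ f=g$. Then, for every $R$-module $E$, the following are equivalent: (1) $E$ is $\mathcal M$-injective relative to $K$; (2) for every $\mathcal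 M$-embedding $f:A\to B$ with $A,B\in K$ and $\|A\|,\|B\|\le \operatorname{card}(R)+\aleph_0$, and every $R$-homomorphism $g:A\to E$, there is an $R$-homomorphism $h:B\to E$ with $h\circ f=g$. Here $\|A\|$ denotes the cardinality of $A$. -/

import Mathlib

universe u v

/-- The three kinds of embeddings of modules: all embeddings, `RD`-embeddings, pure embeddings. -/
inductive EmbeddingKind : Type
  | emb : EmbeddingKind
  | rd : EmbeddingKind
  | pure : EmbeddingKind

/-- `f` is an `RD`-embedding: `f` is injective and `f[A] ∩ rB = r f[A]` for every `r : R`. -/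
def IsRDEmbedding {R : Type u} [Ring R] {A B : Type v} [AddCommGroup A] [Module R A]
    [AddCommGroup B] [Module R B] (f : A →ₗ[R] B) : Prop :=
  Function.Injective f ∧
    ∀ r : R, Set.range f ∩ Set.range (fun b : B => r • b) = (fun b : B => r • b) '' Set.range f

/-- `f` is a pure embedding: `f` is injective and every finite system of linear equations
`∑ i, r j i • x i = f (a j)` (`j < m`, unknowns `x i` for `i < n`) with parameters in `f[A]`
which has a solution in `B` has a solution in `f[A]`. -/
def IsPureEmbedding {R : Type u} [Ring R] {A B : Type v} [AddCommGroup A] [Module R A]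
    [AddCommGroup B] [Module R B] (f : A →ₗ[R] B) : Prop :=
  Function.Injective f ∧
    ∀ (m n : ℕ) (r : Fin m → Fin n → R) (a : Fin m → A),
      (∃ y : Fin n → B, ∀ j, ∑ i, r j i • y i = f (a j)) →
        ∃ x : Fin n → A, ∀ j, ∑ i, r j i • f (x i) = f (a j)

namespace EmbeddingKind

/-- The linear maps that are `𝓜`-embeddings. -/
def IsEmbedding (𝓜 : EmbeddingKind) {R : Type u} [Ring R] {A B : Type v} [AddCommGroup A]
    [Module R A] [AddCommGroup B] [Module R B] (f : A →ₗ[R] B) : Prop :=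
  match 𝓜 with
  | emb => Function.Injective f
  | rd => IsRDEmbedding f
  | pure => IsPureEmbedding f

/-- `N ≤_𝓜 A`: the inclusion of the submodule `N` in `A` is an `𝓜`-embedding. -/
def IsSubmodule (𝓜 : EmbeddingKind) {R : Type u} [Ring R] {A : Type v} [AddCommGroup A]
    [Module R A] (N : Submodule R A) : Prop :=
  𝓜.IsEmbedding N.subtype

/-- `g` is an `𝓜`-epimorphism: `0 → ker g → A → B → 0` is exact and the inclusion of `ker g` is an
`𝓜`-embedding. -/
def IsEpimorphism (𝓜 : EmbeddingKind) {R : Type u} [Ring R] {A B : Type v} [AddCommGroup A]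
    [Module R A] [AddCommGroup B] [Module R B] (g : A →ₗ[R] B) : Prop :=
  Function.Surjective g ∧ 𝓜.IsSubmodule (LinearMap.ker g)

end EmbeddingKind

/-- The class `K` of left `R`-modules is closed under direct sums, `𝓜`-submodules and
`𝓜`-epimorphic images. -/
structure IsAdmissiblePair {R : Type u} [Ring R] (K : ModuleCat.{v} R → Prop)
    (𝓜 : EmbeddingKind) : Prop where
  directSum : ∀ (ι : Type v) (M : ι → ModuleCat.{v} R), (∀ i, K (M i)) →
    K (ModuleCat.of R (DirectSum ι fun i => M i))
  submodule : ∀ (A : ModuleCat.{v} R) (N : Submodule R A), K A → 𝓜.IsSubmodule N →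
    K (ModuleCat.of R N)
  epimorphicImage : ∀ (A B : ModuleCat.{v} R) (g : A →ₗ[R] B), K A → 𝓜.IsEpimorphism g → K B

/-- `E` is `𝓜`-injective relative to `K`: homomorphisms to `E` extend along all `𝓜`-embeddings
between members of `K`. The module `E` may, but need not, be a member of `K`. -/
def IsRelInjective {R : Type u} [Ring R] (K : ModuleCat.{v} R → Prop) (𝓜 : EmbeddingKind)
    (E : ModuleCat.{v} R) : Prop :=
  ∀ (A B : ModuleCat.{v} R), K A → K B → ∀ f : A →ₗ[R] B, 𝓜.IsEmbedding f →
    ∀ g : A →ₗ[R] E, ∃ h : B →ₗ[R] E, h ∘ₗ f = g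

/-!
All three kinds of embeddings are instances of one notion: `f` is an `𝓜`-embedding iff it is
injective and its range is solution-closed for all linear systems of the shapes allowed by `𝓜`
(no system, one equation in one unknown, all finite systems). Call such submodules `𝓜`-pure.

The nontrivial direction is a Baer-type argument. Given an `𝓜`-embedding into `B` and a
homomorphism `g` from its domain to `E`, Zorn's lemma provides a maximal extension of `g` to an
`𝓜`-pure submodule `P` of `B`; here one uses that directed unions of `𝓜`-pure submodules are
`𝓜`-pure. If `b ∉ P`, close `{b}` under Skolem functions which choose solutions of linear systems
in `P` and solutions of linear systems in `B` modulo `P`. By counting terms, the resulting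
submodule `S` has cardinality at most `|R| + ℵ₀`. The closure properties imply that `P ⊓ S`, `S` and
`P ⊔ S` are all `𝓜`-pure in `B`; see `IsSkolemClosed`. In particular `P ⊓ S → S` is an
`𝓜`-embedding between small members of the class, so the restriction of the extension to `P ⊓ S`
extends to `S`, and the two maps glue to a map on `P ⊔ S`, contradicting maximality.

The small submodules belong to the class because they are `𝓜`-pure in `B` itself, and gluing takes
place inside `B`, so no pushout has to be formed.
-/

open Cardinal

/-! ### Purity of submodules -/

/-- The shapes (`m` equations in `n` unknowns) of the linear systems which `𝓜`-embeddings have to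
respect. -/
def EmbeddingKind.Allows : EmbeddingKind → ℕ → ℕ → Prop
  | .emb, _, _ => False
  | .rd, m, n => m = 1 ∧ n = 1
  | .pure, _, _ => True

/-- The submodule `N` of `B` is `𝓜`-pure: every linear system of an allowed shape with parameters
in `N` which is solvable in `B` is solvable in `N`. -/
def EmbeddingKind.IsPureIn (𝓜 : EmbeddingKind) {R : Type u} [Ring R] {B : Type v}
    [AddCommGroup B] [Module R B] (N : Submodule R B) : Prop :=
  ∀ m n, 𝓜.Allows m n → ∀ (r : Fin m → Fin n → R) (a : Fin m → B), (∀ j, a j ∈ N) →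
    (∃ y : Fin n → B, ∀ j, ∑ i, r j i • y i = a j) →
      ∃ x : Fin n → B, (∀ i, x i ∈ N) ∧ ∀ j, ∑ i, r j i • x i = a j

section

variable {R : Type u} [Ring R] {𝓜 : EmbeddingKind}
variable {A B : Type v} [AddCommGroup A] [Module R A] [AddCommGroup B] [Module R B]

theorem EmbeddingKind.isEmbedding_iff (f : A →ₗ[R] B) :
    𝓜.IsEmbedding f ↔ Function.Injective f ∧ 𝓜.IsPureIn (LinearMap.range f) := by
  cases 𝓜 with
  | emb => simp [EmbeddingKind.IsEmbedding, EmbeddingKind.IsPureIn, EmbeddingKind.Allows]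
  | rd =>
    refine and_congr_right fun _ => ⟨?_, ?_⟩
    · rintro H m n ⟨rfl, rfl⟩ r a ha ⟨y, hy⟩
      have hmem : a 0 ∈ Set.range f ∩ Set.range (fun b : B => r 0 0 • b) :=
        ⟨ha 0, y 0, by simpa using hy 0⟩
      rw [H] at hmem
      obtain ⟨x, hx, hxa⟩ := hmem
      refine ⟨fun _ => x, fun _ => hx, fun j => ?_⟩
      obtain rfl := Subsingleton.elim j 0
      simpa using hxa
    · intro H r
      ext b
      constructor
      · rintro ⟨hb, y, rfl⟩
        obtain ⟨x, hx, hxa⟩ := H 1 1 ⟨rfl, rfl⟩ (fun _ _ => r) (fun _ => r • y) (fun _ => hb)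
          ⟨fun _ => y, by simp⟩
        exact ⟨x 0, hx 0, by simpa using hxa 0⟩
      · rintro ⟨_, ⟨a, rfl⟩, rfl⟩
        exact ⟨⟨r • a, by simp⟩, f a, rfl⟩
  | pure =>
    refine and_congr_right fun _ => ⟨?_, ?_⟩
    · rintro H m n - r a ha ⟨y, hy⟩
      choose a' ha' using ha
      obtain ⟨x, hx⟩ := H m n r a' ⟨y, fun j => (hy j).trans (ha' j).symm⟩
      exact ⟨fun i => f (x i), fun i => ⟨x i, rfl⟩, fun j => (hx j).trans (ha' j)⟩
    · rintro H m n r a hy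
      obtain ⟨x, hx, hxa⟩ := H m n trivial r (fun j => f (a j)) (fun j => ⟨a j, rfl⟩) hy
      choose x' hx' using hx
      exact ⟨x', by simpa only [hx'] using hxa⟩

theorem EmbeddingKind.isSubmodule_iff (N : Submodule R B) :
    𝓜.IsSubmodule N ↔ 𝓜.IsPureIn N := by
  rw [EmbeddingKind.IsSubmodule, EmbeddingKind.isEmbedding_iff, Submodule.range_subtype]
  exact and_iff_right N.injective_subtype

/-- Purity is inherited by intermediate submodules. -/
theorem EmbeddingKind.IsPureIn.isEmbedding_inclusion {N S : Submodule R B}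
    (hN : 𝓜.IsPureIn N) (h : N ≤ S) : 𝓜.IsEmbedding (Submodule.inclusion h) := by
  rw [EmbeddingKind.isEmbedding_iff, Submodule.range_inclusion]
  refine ⟨Submodule.inclusion_injective h, fun m n hmn r a ha ⟨y, hy⟩ => ?_⟩
  obtain ⟨x, hx, hxa⟩ := hN m n hmn r (fun j => a j) ha
    ⟨fun i => y i, fun j => by simpa using congrArg Subtype.val (hy j)⟩
  exact ⟨fun i => ⟨x i, h (hx i)⟩, hx, fun j => Subtype.ext (by simpa using hxa j)⟩

theorem EmbeddingKind.IsPureIn.sSup_of_directedOn {c : Set (Submodule R B)} (hne : c.Nonempty)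
    (hdir : DirectedOn (· ≤ ·) c) (hc : ∀ N ∈ c, 𝓜.IsPureIn N) : 𝓜.IsPureIn (sSup c) := by
  intro m n hmn r a ha hy
  obtain ⟨N, hNc, hN⟩ : ∃ N ∈ c, ∀ j, a j ∈ N := by
    choose N hNc haN using fun j => (Submodule.mem_sSup_of_directed hne hdir).1 (ha j)
    have : Nonempty c := hne.to_subtype
    have : IsDirected c (· ≤ ·) := directedOn_univ_iff.1 (by
      rintro ⟨x, hx⟩ - ⟨y, hy⟩ -
      obtain ⟨z, hz, h⟩ := hdir x hx y hy
      exact ⟨⟨z, hz⟩, trivial, h⟩)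
    obtain ⟨M, hM⟩ := Finite.exists_le (fun j => (⟨N j, hNc j⟩ : c))
    exact ⟨M, M.2, fun j => hM j (haN j)⟩
  obtain ⟨x, hx, hxa⟩ := hc N hNc m n hmn r a hN hy
  exact ⟨x, fun i => le_sSup hNc (hx i), hxa⟩

/-! ### Skolem-closed submodules -/

/-- The submodule `S` is closed under choosing solutions of linear systems in `P`, and solutions of
linear systems modulo `P`. In model-theoretic terms this is the part needed here of `(S, P ⊓ S)`
being an elementary substructure of `(B, P)`. -/
structure IsSkolemClosed (P S : Submodule R B) : Prop where
  exists_mem_inf : ∀ {m n : ℕ} (r : Fin m → Fin n → R) (a : Fin m → B), (∀ j, a j ∈ S) →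
    (∃ y : Fin n → B, (∀ i, y i ∈ P) ∧ ∀ j, ∑ i, r j i • y i = a j) →
      ∃ y : Fin n → B, (∀ i, y i ∈ P ⊓ S) ∧ ∀ j, ∑ i, r j i • y i = a j
  exists_sub_mem : ∀ {m n : ℕ} (r : Fin m → Fin n → R) (a : Fin m → B), (∀ j, a j ∈ S) →
    (∃ y : Fin n → B, ∀ j, ∑ i, r j i • y i - a j ∈ P) →
      ∃ y : Fin n → B, (∀ i, y i ∈ S) ∧ ∀ j, ∑ i, r j i • y i - a j ∈ P

theorem IsSkolemClosed.isPureIn_inf {P S : Submodule R B} (h : IsSkolemClosed P S)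
    (hP : 𝓜.IsPureIn P) : 𝓜.IsPureIn (P ⊓ S) := fun m n hmn r a ha hy =>
  h.exists_mem_inf r a (fun j => (ha j).2) (hP m n hmn r a (fun j => (ha j).1) hy)

theorem IsSkolemClosed.isPureIn {P S : Submodule R B} (h : IsSkolemClosed P S)
    (hP : 𝓜.IsPureIn P) : 𝓜.IsPureIn S := by
  rintro m n hmn r a ha ⟨y, hy⟩
  obtain ⟨z, hzS, hz⟩ := h.exists_sub_mem r a ha ⟨y, fun j => by simp [hy]⟩
  -- `z` solves the system modulo `P ⊓ S`; the error is corrected by purity of `P ⊓ S`.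
  obtain ⟨w, hw, hwa⟩ := h.isPureIn_inf hP m n hmn r (fun j => ∑ i, r j i • z i - a j)
    (fun j => ⟨hz j, S.sub_mem (S.sum_mem fun i _ => S.smul_mem _ (hzS i)) (ha j)⟩)
    ⟨z - y, fun j => by simp [smul_sub, hy]⟩
  exact ⟨z - w, fun i => S.sub_mem (hzS i) (hw i).2, fun j => by simp [smul_sub, hwa]⟩

theorem IsSkolemClosed.isPureIn_sup {P S : Submodule R B} (h : IsSkolemClosed P S)
    (hP : 𝓜.IsPureIn P) : 𝓜.IsPureIn (P ⊔ S) := by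
  rintro m n hmn r a ha ⟨y, hy⟩
  choose p hp s hs hps using fun j => Submodule.mem_sup.1 (ha j)
  obtain ⟨z, hzS, hz⟩ := h.exists_sub_mem r s hs
    ⟨y, fun j => by simpa [hy, ← hps] using hp j⟩
  obtain ⟨w, hw, hwa⟩ := hP m n hmn r (fun j => p j - (∑ i, r j i • z i - s j))
    (fun j => P.sub_mem (hp j) (hz j))
    ⟨y - z, fun j => by simp only [Pi.sub_apply, smul_sub, Finset.sum_sub_distrib, hy, ← hps]; abel⟩
  refine ⟨w + z, fun i => Submodule.add_mem_sup (hw i) (hzS i), fun j => ?_⟩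
  simp only [Pi.add_apply, smul_add, Finset.sum_add_distrib, hwa, ← hps]
  abel

/-! ### Small Skolem-closed submodules -/

/-- The language with a `k`-ary symbol for every linear combination of `k` elements, and, for each
linear system of `k` equations, symbols for the coordinates of a solution in terms of the right
hand side. The Boolean distinguishes the two kinds of solutions in `IsSkolemClosed`. -/
def skolemLanguage (R : Type u) : FirstOrder.Language.{u, 0} where
  Functions k := (Fin k → R) ⊕ (Σ n : ℕ, (Fin k → Fin n → R) × Fin n × Bool)
  Relations _ := Empty

theorem mk_sigma_le_of_countable {ι : Type} [Countable ι] (α : ι → Type u) {κ : Cardinal.{u}}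
    (hκ : ℵ₀ ≤ κ) (h : ∀ i, #(α i) ≤ κ) : #(Σ i, α i) ≤ κ := by
  rw [mk_sigma]
  refine (sum_le_sum _ (fun _ => κ) h).trans ?_
  rw [sum_const]
  refine (mul_le_max_of_aleph0_le_right (by simpa using hκ)).trans ?_
  simpa using (lift_le_aleph0.2 (mk_le_aleph0 (α := ι))).trans hκ

theorem mk_fin_fun_le (α : Type u) {κ : Cardinal.{u}} (hκ : ℵ₀ ≤ κ) (h : #α ≤ κ) (k : ℕ) :
    #(Fin k → α) ≤ κ := by
  have : #(Fin k → α) = #α ^ (k : Cardinal.{u}) := by simp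
  rw [this]
  exact power_nat_le_max.trans (max_le h hκ)

theorem mk_skolemLanguage_functions_le (R : Type u) :
    #(Σ k, (skolemLanguage R).Functions k) ≤ max #R ℵ₀ := by
  have hκ : ℵ₀ ≤ max #R ℵ₀ := le_max_right _ _
  refine mk_sigma_le_of_countable _ hκ fun k => ?_
  change #((Fin k → R) ⊕ (Σ n : ℕ, (Fin k → Fin n → R) × Fin n × Bool)) ≤ _
  rw [mk_sum, lift_id, lift_id]
  refine add_le_of_le hκ (mk_fin_fun_le R hκ (le_max_left _ _) k)
    (mk_sigma_le_of_countable _ hκ fun n => ?_)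
  rw [mk_prod]
  refine (mul_le_max _ _).trans (max_le (max_le ?_ ?_) hκ)
  · simpa using mk_fin_fun_le _ hκ (mk_fin_fun_le R hκ (le_max_left _ _) n) k
  · exact (lift_le_aleph0.2 mk_le_aleph0).trans hκ

/-- The relation between right hand sides and solutions which is uniformized by the Skolem
functions. -/
def IsSolution (P : Submodule R B) {m n : ℕ} (r : Fin m → Fin n → R) (a : Fin m → B)
    (y : Fin n → B) : Bool → Prop
  | true => (∀ i, y i ∈ P) ∧ ∀ j, ∑ i, r j i • y i = a j
  | false => ∀ j, ∑ i, r j i • y i - a j ∈ P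

open Classical in
/-- A solution in the sense of `IsSolution` if there is one, and `0` otherwise. -/
noncomputable def chosenSolution (P : Submodule R B) {m n : ℕ} (r : Fin m → Fin n → R)
    (a : Fin m → B) (t : Bool) : Fin n → B :=
  if h : ∃ y, IsSolution P r a y t then h.choose else 0

theorem isSolution_chosenSolution (P : Submodule R B) {m n : ℕ} (r : Fin m → Fin n → R)
    (a : Fin m → B) (t : Bool) (h : ∃ y, IsSolution P r a y t) :
    IsSolution P r a (chosenSolution P r a t) t := by
  rw [chosenSolution, dif_pos h]
  exact h.choose_spec

/-- The interpretation of the Skolem functions in `B`, relative to `P`. -/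
@[reducible]
noncomputable def skolemStructure (P : Submodule R B) : (skolemLanguage R).Structure B where
  funMap {k} f a :=
    match f with
    | .inl r => ∑ i : Fin k, r i • a i
    | .inr ⟨_, r, i, t⟩ => chosenSolution P r a t i
  RelMap s := s.elim

theorem exists_isSkolemClosed (P : Submodule R B) (b : B) :
    ∃ S : Submodule R B, b ∈ S ∧ IsSkolemClosed P S ∧
      lift.{u} #S ≤ lift.{v} #R + ℵ₀ := by
  let := skolemStructure P
  let T := FirstOrder.Language.Substructure.closure (skolemLanguage R) ({b} : Set B)
  have hlin : ∀ {k : ℕ} (r : Fin k → R) (a : Fin k → B), (∀ j, a j ∈ T) → ∑ i, r i • a i ∈ T :=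
    fun {k} r a ha => T.fun_mem (n := k) (Sum.inl r) a ha
  have hsol : ∀ {m n : ℕ} (r : Fin m → Fin n → R) (a : Fin m → B) (t : Bool), (∀ j, a j ∈ T) →
      ∀ i, chosenSolution P r a t i ∈ T :=
    fun {m n} r a t ha i => T.fun_mem (n := m) (Sum.inr ⟨n, r, i, t⟩) a ha
  let S : Submodule R B :=
    { carrier := T
      zero_mem' := by simpa using hlin (k := 0) ![] ![] (fun j => j.elim0)
      add_mem' := fun {x y} hx hy => by
        simpa using hlin (k := 2) ![1, 1] ![x, y] (Fin.forall_fin_two.2 ⟨hx, hy⟩)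
      smul_mem' := fun c x hx => by
        simpa using hlin (k := 1) ![c] ![x] (Fin.forall_fin_one.2 hx) }
  refine ⟨S, FirstOrder.Language.Substructure.subset_closure rfl, ⟨?_, ?_⟩, ?_⟩
  · intro m n r a ha hy
    have h := isSolution_chosenSolution P r a true hy
    exact ⟨_, fun i => ⟨h.1 i, hsol r a true ha i⟩, h.2⟩
  · intro m n r a ha hy
    exact ⟨_, hsol r a false ha, isSolution_chosenSolution P r a false hy⟩
  · have hcard := FirstOrder.Language.Substructure.lift_card_closure_le
      (L := skolemLanguage R) (s := ({b} : Set B))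
    have hκ : ℵ₀ ≤ lift.{v} #R + ℵ₀ := self_le_add_left _ _
    refine hcard.trans (max_le hκ (add_le_of_le hκ ?_ ?_))
    · simpa using one_le_aleph0.trans hκ
    · refine (lift_le.2 (mk_skolemLanguage_functions_le R)).trans ?_
      rw [lift_max, lift_aleph0]
      exact max_le (self_le_add_right _ _) hκ

/-! ### Extension of homomorphisms -/

/-- Homomorphisms into `E` can be extended along `𝓜`-embeddings between small members of `K`. -/
def IsSmallRelInjective (K : ModuleCat.{v} R → Prop) (𝓜 : EmbeddingKind)
    (E : ModuleCat.{v} R) : Prop :=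
  ∀ (A B : ModuleCat.{v} R), K A → K B →
    lift.{u} #A ≤ lift.{v} #R + ℵ₀ → lift.{u} #B ≤ lift.{v} #R + ℵ₀ →
      ∀ f : A →ₗ[R] B, 𝓜.IsEmbedding f → ∀ g : A →ₗ[R] E, ∃ h : B →ₗ[R] E, h ∘ₗ f = g

/-- A homomorphism defined on an `𝓜`-pure submodule extends to an `𝓜`-pure submodule containing
any prescribed element. -/
theorem exists_extension_of_mem {K : ModuleCat.{v} R → Prop} (hK : IsAdmissiblePair K 𝓜)
    {E : ModuleCat.{v} R} (hE : IsSmallRelInjective K 𝓜 E) {B : ModuleCat.{v} R} (hB : K B)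
    (p : B →ₗ.[R] E) (hp : 𝓜.IsPureIn p.domain) (b : B) :
    ∃ q : B →ₗ.[R] E, p ≤ q ∧ 𝓜.IsPureIn q.domain ∧ b ∈ q.domain := by
  obtain ⟨S, hbS, hS, hcard⟩ := exists_isSkolemClosed p.domain b
  have hinf := hS.isPureIn_inf hp
  have hle : lift.{u} #(p.domain ⊓ S : Submodule R B) ≤ lift.{v} #R + ℵ₀ :=
    (lift_le.2 (mk_le_of_injective (Submodule.inclusion_injective inf_le_right))).trans hcard
  obtain ⟨h, hh⟩ := hE (ModuleCat.of R (p.domain ⊓ S : Submodule R B)) (ModuleCat.of R S)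
    (hK.submodule B _ hB ((EmbeddingKind.isSubmodule_iff _).2 hinf))
    (hK.submodule B _ hB ((EmbeddingKind.isSubmodule_iff _).2 (hS.isPureIn hp))) hle hcard
    (Submodule.inclusion inf_le_right) (hinf.isEmbedding_inclusion inf_le_right)
    (p.toFun ∘ₗ Submodule.inclusion inf_le_left)
  have hagree : ∀ (x : p.domain) (y : S), (x : B) = y → p x = h y := by
    rintro ⟨x, hx⟩ ⟨_, hy⟩ rfl
    exact (LinearMap.congr_fun hh ⟨x, hx, hy⟩).symm
  exact ⟨p.sup ⟨S, h⟩ hagree, p.left_le_sup _ hagree, hS.isPureIn_sup hp,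
    Submodule.mem_sup_right hbS⟩

theorem IsSmallRelInjective.isRelInjective {K : ModuleCat.{v} R → Prop}
    (hK : IsAdmissiblePair K 𝓜) {E : ModuleCat.{v} R} (hE : IsSmallRelInjective K 𝓜 E) :
    IsRelInjective K 𝓜 E := by
  intro A B _ hB f hf g
  obtain ⟨hinj, hrange⟩ := (EmbeddingKind.isEmbedding_iff f).1 hf
  let e := LinearEquiv.ofInjective f hinj
  let p₀ : B →ₗ.[R] E := ⟨LinearMap.range f, g ∘ₗ e.symm.toLinearMap⟩
  obtain ⟨q, hpq, hq⟩ := zorn_le_nonempty₀ {q : B →ₗ.[R] E | 𝓜.IsPureIn q.domain}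
    (fun c hc hchain y hy => by
      refine ⟨LinearPMap.sSup c hchain.directedOn, ?_, fun z hz => LinearPMap.le_sSup _ hz⟩
      change 𝓜.IsPureIn (sSup (LinearPMap.domain '' c))
      refine EmbeddingKind.IsPureIn.sSup_of_directedOn ⟨_, y, hy, rfl⟩ ?_ ?_
      · exact directedOn_image.2 (hchain.directedOn.mono fun _ _ h => h.1)
      · rintro _ ⟨z, hz, rfl⟩
        exact hc hz) p₀ hrange
  have htop : ∀ b : B, b ∈ q.domain := fun b => by
    obtain ⟨q', hqq', hq', hb⟩ := exists_extension_of_mem hK hE hB q hq.1 b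
    exact (hq.2 hq' hqq').1 hb
  refine ⟨q.toFun ∘ₗ LinearMap.id.codRestrict q.domain htop, LinearMap.ext fun a => ?_⟩
  -- `h` states that `q` agrees with `g ∘ e⁻¹` at `e a = f a`.
  have h := hpq.2 (x := e a) (y := ⟨f a, htop _⟩) rfl
  exact h.symm.trans (congrArg g (e.symm_apply_apply a))

end

theorem theorem4 {R : Type u} [Ring R] (K : ModuleCat.{v} R → Prop) (𝓜 : EmbeddingKind)
    (hK : IsAdmissiblePair K 𝓜) (E : ModuleCat.{v} R) :
    IsRelInjective K 𝓜 E ↔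
      ∀ (A B : ModuleCat.{v} R), K A → K B →
        Cardinal.lift.{u} (Cardinal.mk A) ≤
          Cardinal.lift.{v} (Cardinal.mk R) + Cardinal.aleph0 →
        Cardinal.lift.{u} (Cardinal.mk B) ≤
          Cardinal.lift.{v} (Cardinal.mk R) + Cardinal.aleph0 →
        ∀ f : A →ₗ[R] B, 𝓜.IsEmbedding f →
          ∀ g : A →ₗ[R] E, ∃ h : B →ₗ[R] E, h ∘ₗ f = g :=
  ⟨fun h A B hA hB _ _ f hf g => h A B hA hB f hf g,
    fun h => IsSmallRelInjective.isRelInjective hK h⟩
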